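/- Let $R$ be a Dedekind domain with quotient field $K$, let $G$ be a finite group with neutral element $e$ acting on $R$ by ring automorphisms $\sigma_g$ (extended to $K$), and let $R^G$ be the ring of invariants. Let $A = K\diamondsuit_{\sigma,\alpha} G$ be a crystalline graded ring: a ring containing $K$ (with the same unit), together with an injection $u:G\to A\setminus\{0\}$, $u_e=1$, such that $A=\bigoplus_{g\in G}Ku_g$, where $Ku_g=u_gK$ is a free left $K$-module with basis $u_g$ and $u_g x=\sigma_g(x)u_g$ for $x \in K$, where $u_gu_h=\alpha(g,h)u_{gh}$ with $\alpha(g,h)\in K$ (so that $A$ is $G$-graded with $A_g=Ku_g$), and where $\alpha(g,h)x=0$ with $x \in K$ implies $x=0$. A full $R$-lattice in $A$ is a torsion-free sub-$R$-bimodule $M$ of $A$ that is finitely generated both as a left and as a right $R$-module and satisfies $KM=A=MK$. A subset of $A$ is graded if it contains the homogeneous components of all its elements. Let $\Lambda$ be a graded order in $A$, i.e. a subring of $A$ with the same unit that is a graded full $R$-lattice. A two-sided graded Ideal of $\Lambda$ is a two-sided ideal of $\Lambda$ that is graded and is a full $R$-lattice in $A$. Such an Ideal $P\neq\Lambda$ is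 gr-prime if, for all two-sided graded Ideals $S,T$ of $\Lambda$, $ST\subseteq P$ implies $S\subseteq P$ or $T\subseteq P$; it is gr-maximal if it is maximal among the two-sided graded Ideals different from $\Lambda$. Then the gr-prime Ideals of $\Lambda$ coincide with the gr-maximal two-sided Ideals of $\Lambda$. If $P$ is a gr-prime Ideal of $\Lambda$ and $P_e=P\cap A_e$ is its part of degree $e$, then $P_e=P\cap R$; the ideal $p=P\cap R^G=P_e\cap R^G$ is a nonzero prime (hence maximal) ideal of $R^G$, and $p=P_e$ if and only if $G$ acts trivially on $R$; and $\Lambda/P$, with the grading induced by that of $\Lambda$ and the $R^G$-action induced by $R^G \subseteq \Lambda$, is a finite dimensional gr-simple algebra over the field $R^G/p$, that is, it is nonzero and its only graded two-sided ideals are $0$ and $\Lambda/P$. -/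

import Mathlib

namespace Crystalline

/-- Crystalline graded rings `A = B ◇ G`: `ι` embeds the base ring `B` in `A` and `u : G → A` is the
family of homogeneous generators. -/
structure IsCrystallineGraded {B A G : Type*} [Ring B] [Ring A] [Group G]
    (ι : B →+* A) (u : G → A) : Prop where
  ι_injective : Function.Injective ι
  u_injective : Function.Injective u
  u_ne_zero : ∀ g, u g ≠ 0
  u_one : u 1 = 1
  /-- `A` is the direct sum of the `B u_g`, each of them free as a left module with basis `u_g`. -/
  direct_sum : Function.Bijective (fun c : G →₀ B => c.sum fun g b => ι b * u g)
  /-- `B u_g = u_g B`. -/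
  left_eq_right : ∀ g, Set.range (fun b => ι b * u g) = Set.range (fun b => u g * ι b)
  /-- The direct sum is a grading: `(B u_g) (B u_h) ⊆ B u_{gh}`. -/
  graded : ∀ g h, ∀ b c : B, ∃ d : B, (ι b * u g) * (ι c * u h) = ι d * u (g * h)
  /-- Torsion-freeness with respect to the elements `α(g,h)` given by `u_g u_h = α(g,h) u_{gh}`. -/
  torsion_free : ∀ g h, ∀ a r : B, u g * u h = ι a * u (g * h) → a * r = 0 → r = 0

/-- The homogeneous component `A_g = B u_g`. -/
def component {B A G : Type*} [Ring B] [Ring A] (ι : B →+* A) (u : G → A) (g : G) :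
    AddSubgroup A :=
  ((AddMonoidHom.mulRight (u g)).comp ι.toAddMonoidHom).range

/-- A subset `T` of `A` is graded if it contains the homogeneous components `x_g u_g` of each of
its elements `∑ x_g u_g`. -/
def IsGradedSet {B A G : Type*} [Ring B] [Ring A] (ι : B →+* A) (u : G → A) (T : Set A) : Prop :=
  ∀ c : G →₀ B, (c.sum fun g b => ι b * u g) ∈ T → ∀ g, ι (c g) * u g ∈ T

section Lattices

variable (R : Type*) {K A : Type*} [CommRing R] [Field K] [Algebra R K] [Ring A]

/-- The embedding of `R` in `A`, through its fraction field `K`. -/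
def baseHom (ι : K →+* A) : R →+* A := ι.comp (algebraMap R K)

/-- An `R`-lattice in `A`: a sub-`R`-bimodule that is torsion-free and finitely generated, both as
a left and as a right `R`-module. -/
structure IsLattice (ι : K →+* A) (M : AddSubgroup A) : Prop where
  left_mem : ∀ r : R, ∀ x ∈ M, baseHom R ι r * x ∈ M
  right_mem : ∀ r : R, ∀ x ∈ M, x * baseHom R ι r ∈ M
  left_torsion_free : ∀ r : R, ∀ x ∈ M, baseHom R ι r * x = 0 → r = 0 ∨ x = 0
  right_torsion_free : ∀ r : R, ∀ x ∈ M, x * baseHom R ι r = 0 → r = 0 ∨ x = 0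
  left_fg : ∃ s : Finset A,
    M = AddSubgroup.closure {y | ∃ r : R, ∃ x ∈ s, y = baseHom R ι r * x}
  right_fg : ∃ s : Finset A,
    M = AddSubgroup.closure {y | ∃ r : R, ∃ x ∈ s, y = x * baseHom R ι r}

/-- A full `R`-lattice in `A`: `K M = A = M K`. -/
structure IsFullLattice (ι : K →+* A) (M : AddSubgroup A) : Prop extends IsLattice R ι M where
  left_full : AddSubgroup.closure {y | ∃ k : K, ∃ x ∈ M, y = ι k * x} = ⊤
  right_full : AddSubgroup.closure {y | ∃ k : K, ∃ x ∈ M, y = x * ι k} = ⊤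

variable {G : Type*}

/-- A graded `R`-order in `A`: a subring (with the same identity) that is a graded full
`R`-lattice. -/
structure IsGradedOrder (ι : K →+* A) (u : G → A) (Λ : Subring A) : Prop where
  full : IsFullLattice R ι Λ.toAddSubgroup
  graded : IsGradedSet ι u (Λ : Set A)

theorem IsGradedOrder.baseHom_mem {ι : K →+* A} {u : G → A} {Λ : Subring A}
    (hΛ : IsGradedOrder R ι u Λ) (r : R) : baseHom R ι r ∈ Λ := by
  have h := hΛ.full.left_mem r 1 Λ.one_mem
  rwa [mul_one] at h

/-- The invariant ring `R^G`, mapped into the order `Λ`. -/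
def fixedToOrder [Group G] [MulSemiringAction G R] {ι : K →+* A} {u : G → A} {Λ : Subring A}
    (hΛ : IsGradedOrder R ι u Λ) : FixedPoints.subring R G →+* Λ :=
  ((baseHom R ι).comp (FixedPoints.subring R G).subtype).codRestrict Λ
    fun a => hΛ.baseHom_mem R a

/-- An ideal of the order `Λ`, viewed as a subgroup of `A`. -/
def inAmbient {Λ : Subring A} (P : Ideal Λ) : AddSubgroup A :=
  (Submodule.toAddSubgroup P).map Λ.subtype.toAddMonoidHom

/-- Two-sided graded Ideals of `Λ`. All "Ideals" are full `R`-lattices in `A`. -/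
structure IsGrIdeal (ι : K →+* A) (u : G → A) {Λ : Subring A} (P : Ideal Λ) : Prop where
  two_sided : P.IsTwoSided
  full : IsFullLattice R ι (inAmbient P)
  graded : IsGradedSet ι u (inAmbient P : Set A)

/-- gr-prime Ideals of `Λ`. (As `P` is closed under addition, `S T ⊆ P` may be tested on products
of two elements.) -/
structure IsGrPrime (ι : K →+* A) (u : G → A) {Λ : Subring A} (P : Ideal Λ) : Prop where
  gr_ideal : IsGrIdeal R ι u P
  proper : P ≠ ⊤
  prime : ∀ S T : Ideal Λ, IsGrIdeal R ι u S → IsGrIdeal R ι u T →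
    (∀ s ∈ S, ∀ t ∈ T, s * t ∈ P) → S ≤ P ∨ T ≤ P

/-- gr-maximal two-sided Ideals of `Λ`: maximal among the proper two-sided graded Ideals. -/
structure IsGrMaximal (ι : K →+* A) (u : G → A) {Λ : Subring A} (P : Ideal Λ) : Prop where
  gr_ideal : IsGrIdeal R ι u P
  proper : P ≠ ⊤
  maximal : ∀ Q : Ideal Λ, IsGrIdeal R ι u Q → Q ≠ ⊤ → P ≤ Q → Q = P

end Lattices

/-- The image in `Λ ⧸ P` of the homogeneous component `Λ_g = Λ ∩ A_g`. -/
def quotientComponent {B A G : Type*} [Ring B] [Ring A] (ι : B →+* A) (u : G → A) {Λ : Subring A}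
    (P : Ideal Λ) [P.IsTwoSided] (g : G) : AddSubgroup (Λ ⧸ P) :=
  ((component ι u g).comap Λ.subtype.toAddMonoidHom).map (Ideal.Quotient.mk P).toAddMonoidHom

open Classical in
/-- A ring `Q` with a `G`-grading `𝒜` is gr-simple if it is nonzero and its only graded two-sided
ideals are `0` and `Q`. -/
structure IsGrSimple {G Q : Type*} [Group G] [Ring Q] (𝒜 : G → AddSubgroup Q) : Prop where
  internal : DirectSum.IsInternal 𝒜
  one_mem : 1 ∈ 𝒜 1
  mul_mem : ∀ g h, ∀ x ∈ 𝒜 g, ∀ y ∈ 𝒜 h, x * y ∈ 𝒜 (g * h)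
  nontrivial : Nontrivial Q
  simple : ∀ J : Ideal Q, J.IsTwoSided →
    (∀ c : G →₀ Q, (∀ g, c g ∈ 𝒜 g) → (c.sum fun _ x => x) ∈ J → ∀ g, c g ∈ J) →
    J = ⊥ ∨ J = ⊤

end Crystalline

/-!
For a gr-prime Ideal `P`, put `p = P ∩ R^G`. The ring `Λ / P` is module-finite over `R^G / p`,
because `R^G` is again a Dedekind domain over which `R` is finite: to see that an ideal `a` of `R^G`
is locally principal, choose generators after extending it to `R`; the residual ideals `(x) : a`
formed in `R` are `G`-stable, and a `G`-stable ideal lies in a prime of `R` as soon as its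
contraction lies in the contracted prime. As `P` contains a nonzero element of `R`, the prime `p` is
nonzero, so `Λ / P` is finite-dimensional over a field and hence Artinian.

In a gr-prime Artinian ring, let `I ≠ 0` be a graded two-sided ideal, `L` a minimal nonzero graded
left ideal and `N` a minimal graded left ideal with `N + I` the whole ring. Minimality forces
`N L = 0`, so `N = 0` by gr-primality and `I` is everything. Thus `Λ / P` is gr-simple and `P` is
gr-maximal. Conversely, if `P` is gr-maximal and `S T ⊆ P`, then the residual ideal `P : T` is
graded and contains both `P` and `S`, so it is either `P` or all of `Λ`.
-/

namespace Crystalline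

section InvariantRing

theorem exists_mem_not_colon_le {B : Type*} [CommRing B] [IsDedekindDomain B] {S : Set B}
    (hS : S.Nonempty) {q : Ideal B} (hq : q ≠ ⊤) : ∃ x ∈ S, ¬ (Ideal.span {x}).colon S ≤ q := by
  set J := Ideal.span S
  by_cases hJ : J = ⊥
  · obtain ⟨x, hx⟩ := hS
    refine ⟨x, hx, fun h => hq (top_le_iff.1 (le_trans (Eq.ge ?_) h))⟩
    exact (Submodule.colon_eq_top_iff_subset S).2 fun y hy => by
      rw [show y = 0 from Ideal.span_eq_bot.1 hJ y hy]
      exact zero_mem _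
  -- For `x ∈ S` outside `J * q`, writing `(x) = J * E` gives `E ≤ (x) : S` and `E ≰ q`.
  obtain ⟨x, hxS, hxJq⟩ : ∃ x ∈ S, x ∉ J * q := by
    by_contra! h
    exact hq (mul_left_cancel₀ hJ
      ((le_antisymm Ideal.mul_le_left (Ideal.span_le.2 h)).trans J.mul_top.symm))
  obtain ⟨E, hE⟩ := Ideal.dvd_iff_le.2
    ((Ideal.span_singleton_le_iff_mem J).2 (Ideal.subset_span hxS))
  have hED : E ≤ (Ideal.span {x}).colon S := fun t ht => Submodule.mem_colon.2 fun y hy => by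
    rw [hE, smul_eq_mul, mul_comm t]
    exact Ideal.mul_mem_mul (Ideal.subset_span hy) ht
  exact ⟨x, hxS, fun hDq =>
    hxJq (Ideal.mul_mono_right (hED.trans hDq) (hE ▸ Ideal.mem_span_singleton_self x))⟩

variable {A B G : Type*} [CommRing A] [CommRing B] [Algebra A B] [Group G]
  [MulSemiringAction G B] [SMulCommClass G A B] [Algebra.IsInvariant A B G]

variable (A B G) in
theorem isGaloisGroup_range_toAlgAut :
    IsGaloisGroup (MulSemiringAction.toAlgAut G A B).range A B where
  faithful := inferInstance
  commutes := inferInstance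
  isInvariant :=
    ⟨fun b hb => Algebra.IsInvariant.isInvariant (G := G) b fun g => hb ⟨_, g, rfl⟩⟩

variable (G) in
include G in
theorem dvd_of_algebraMap_dvd_algebraMap [FaithfulSMul A B] [IsDomain B] {x y : A}
    (h : algebraMap A B x ∣ algebraMap A B y) : x ∣ y := by
  have hinj := FaithfulSMul.algebraMap_injective A B
  obtain ⟨b, hb⟩ := h
  rcases eq_or_ne x 0 with rfl | hx
  · exact zero_dvd_iff.2 (hinj (by rw [hb, map_zero, zero_mul]))
  have hbG : ∀ g : G, g • b = b := fun g => by
    have hx' : algebraMap A B x ≠ 0 := (map_ne_zero_iff _ hinj).2 hx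
    refine mul_left_cancel₀ hx' ?_
    rw [← hb, ← smul_algebraMap g x, ← smul_mul', ← hb, smul_algebraMap]
  obtain ⟨c, rfl⟩ := Algebra.IsInvariant.isInvariant (A := A) b hbG
  exact ⟨c, hinj (by rw [hb, map_mul])⟩

variable (A B G) in
include B G in
theorem isIntegrallyClosed_of_isInvariant [FaithfulSMul A B] [IsDomain B] [IsIntegrallyClosed B] :
    IsIntegrallyClosed A := by
  have : IsDomain A := (FaithfulSMul.algebraMap_injective A B).isDomain
  let K := FractionRing A
  let L := FractionRing B
  let : Algebra K L := FractionRing.liftAlgebra A L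
  have algebraMap_comm (a : A) :
      algebraMap B L (algebraMap A B a) = algebraMap K L (algebraMap A K a) := by
    rw [← IsScalarTower.algebraMap_apply, ← IsScalarTower.algebraMap_apply]
  refine (isIntegrallyClosed_iff K).2 fun {k} hk => ?_
  obtain ⟨x, y, hy, rfl⟩ := IsFractionRing.div_surjective A k
  have hy0 : algebraMap A K y ≠ 0 := IsFractionRing.to_map_ne_zero_of_mem_nonZeroDivisors hy
  obtain ⟨b, hb⟩ := IsIntegrallyClosed.isIntegral_iff.1
    ((hk.map (IsScalarTower.toAlgHom A K L)).tower_top (A := B))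
  obtain ⟨c, rfl⟩ : y ∣ x :=
    dvd_of_algebraMap_dvd_algebraMap (B := B) G ⟨b, IsFractionRing.injective B L <| by
      rw [map_mul, hb, algebraMap_comm, algebraMap_comm, IsScalarTower.coe_toAlgHom', ← map_mul,
        mul_div_cancel₀ _ hy0]⟩
  exact ⟨c, by rw [map_mul, mul_div_cancel_left₀ _ hy0]⟩

variable [Finite G]

variable (A G) in
theorem le_of_under_le_of_forall_smul_mem {D q : Ideal B} [q.IsPrime]
    (hD : ∀ g : G, ∀ t ∈ D, g • t ∈ D) (hle : D.under A ≤ q.under A) : D ≤ q := by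
  have := Algebra.IsInvariant.isIntegral A B G
  obtain ⟨q', hDq', _, hq'⟩ := Ideal.exists_ideal_over_prime_of_isIntegral (q.under A) D hle
  obtain ⟨g, rfl⟩ := Algebra.IsInvariant.exists_smul_of_under_eq A B G q q' hq'.symm
  exact fun t ht => Ideal.smul_mem_pointwise_smul_iff.1 (hDq' (hD g t ht))

variable [FaithfulSMul A B] [IsDedekindDomain B]

variable (B G) in
include B G in
theorem exists_notMem_forall_dvd_mul (a : Ideal A) (p : Ideal A) [p.IsPrime] :
    ∃ x ∈ a, ∃ t ∉ p, ∀ y ∈ a, x ∣ t * y := by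
  have := Algebra.IsInvariant.isIntegral A B G
  obtain ⟨q, hq, hqp⟩ := Ideal.nonempty_primesOver (S := B) p
  obtain ⟨_, ⟨x, hxa, rfl⟩, hDq⟩ :=
    exists_mem_not_colon_le (S := algebraMap A B '' a) ⟨_, 0, a.zero_mem, rfl⟩ hq.ne_top
  set D : Ideal B := (Ideal.span {algebraMap A B x}).colon (algebraMap A B '' a)
  have mem_D {t : B} : t ∈ D ↔ ∀ y ∈ a, algebraMap A B x ∣ t * algebraMap A B y := by
    simp only [D, Submodule.mem_colon, Set.forall_mem_image, SetLike.mem_coe, smul_eq_mul,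
      Ideal.mem_span_singleton]
  have smul_mem_D (g : G) : ∀ t ∈ D, g • t ∈ D := fun t ht => mem_D.2 fun y hy => by
    obtain ⟨c, hc⟩ := mem_D.1 ht y hy
    exact ⟨g • c, by rw [← smul_algebraMap g y, ← smul_mul', hc, smul_mul', smul_algebraMap]⟩
  obtain ⟨t, htD, htq⟩ :=
    Set.not_subset.1 (mt (le_of_under_le_of_forall_smul_mem A G smul_mem_D) hDq)
  refine ⟨x, hxa, t, fun ht => htq (hqp.over ▸ ht), fun y hy =>
    dvd_of_algebraMap_dvd_algebraMap (B := B) G ?_⟩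
  rw [map_mul]
  exact mem_D.1 htD y hy

variable (A B G)

include B G in
theorem isNoetherianRing_of_isInvariant : IsNoetherianRing A := by
  refine isNoetherianRing_iff_ideal_fg A |>.2 fun a => ?_
  have hspan : Ideal.span {t : A | ∃ x ∈ a, ∀ y ∈ a, x ∣ t * y} = ⊤ := by
    by_contra h
    obtain ⟨p, hp, hle⟩ := Ideal.exists_le_maximal _ h
    obtain ⟨x, hx, t, ht, hxt⟩ := exists_notMem_forall_dvd_mul B G a p
    exact ht (hle (Ideal.subset_span ⟨x, hx, hxt⟩))
  obtain ⟨s, hs, hs1⟩ := (Ideal.span_eq_top_iff_finite _).1 hspan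
  choose! x hxa hx using hs
  classical
  refine ⟨s.image x, le_antisymm (Submodule.span_le.2 ?_) fun y hy => ?_⟩
  · intro _ hx'
    obtain ⟨t, ht, rfl⟩ := Finset.mem_image.1 hx'
    exact hxa ht
  · have hle : Ideal.span (s : Set A) ≤ (Ideal.span (x '' s)).colon {y} :=
      Ideal.span_le.2 fun t ht => Submodule.mem_colon_singleton.2 <|
        Ideal.mem_of_dvd _ (hx ht y hy) (Ideal.subset_span (Set.mem_image_of_mem x ht))
    rw [hs1, top_le_iff, Submodule.colon_eq_top_iff_subset, Set.singleton_subset_iff] at hle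
    rwa [Finset.coe_image]

include B G in
theorem isDedekindDomain_of_isInvariant : IsDedekindDomain A := by
  have : IsDomain A := (FaithfulSMul.algebraMap_injective A B).isDomain
  have := Algebra.IsInvariant.isIntegral A B G
  have := isNoetherianRing_of_isInvariant A B G
  have := isIntegrallyClosed_of_isInvariant A B G
  have : Ring.DimensionLEOne A := ⟨fun {p} hp0 hp => by
    obtain ⟨q, hq, hqp⟩ := Ideal.nonempty_primesOver (S := B) p
    have hq0 : q ≠ ⊥ := by
      rintro rfl
      exact hp0 (by rw [hqp.over, Ideal.under_bot])
    have := hq.isMaximal hq0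
    rw [hqp.over]
    exact Ideal.isMaximal_comap_of_isIntegral_of_isMaximal q⟩
  exact { }

include G in
theorem finite_of_isInvariant : Module.Finite A B := by
  have : IsDomain A := (FaithfulSMul.algebraMap_injective A B).isDomain
  have := Algebra.IsInvariant.isIntegral A B G
  have := isDedekindDomain_of_isInvariant A B G
  let K := FractionRing A
  let L := FractionRing B
  let : Algebra K L := FractionRing.liftAlgebra A L
  let : MulSemiringAction G L := IsFractionRing.mulSemiringAction G B L
  have := IsFractionRing.smulCommClass G A B K L
  have := IsFractionRing.isInvariant G A B K L
  -- `G` need not act faithfully, so Galois theory is applied to its image in `Aut (L / K)`.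
  let σ := MulSemiringAction.toAlgAut G K L
  have : Finite σ.range := Finite.of_surjective _ σ.rangeRestrict_surjective
  have : IsGaloisGroup σ.range K L := isGaloisGroup_range_toAlgAut K L G
  have := IsGaloisGroup.isGalois σ.range K L
  have := IsGaloisGroup.finiteDimensional σ.range K L
  exact IsIntegralClosure.finite A K L B

end InvariantRing

section Grading

variable {G Q : Type*} [Group G] [Fintype G] [Ring Q]

/-- A `G`-grading of the ring `Q` with homogeneous components `𝒜 g`. The projections `π g` onto the
components are recorded as additive maps, so that gradings pass easily to subrings and quotients. -/
structure IsGrading (𝒜 : G → AddSubgroup Q) (π : G → Q →+ Q) : Prop where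
  one_mem : 1 ∈ 𝒜 1
  mul_mem : ∀ g h, ∀ x ∈ 𝒜 g, ∀ y ∈ 𝒜 h, x * y ∈ 𝒜 (g * h)
  proj_mem : ∀ g x, π g x ∈ 𝒜 g
  proj_self : ∀ g, ∀ x ∈ 𝒜 g, π g x = x
  proj_of_ne : ∀ g h, g ≠ h → ∀ x ∈ 𝒜 h, π g x = 0
  sum_proj : ∀ x, ∑ g, π g x = x

/-- Graded left ideals: those stable under the projections `π g` onto the homogeneous components. -/
def IsHomogeneous {G Q : Type*} [Ring Q] (π : G → Q →+ Q) (I : Ideal Q) : Prop :=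
  ∀ x ∈ I, ∀ g, π g x ∈ I

/-- gr-prime rings: the zero ideal satisfies the elementwise form of primality on homogeneous
elements. -/
def IsGrPrimeRing (𝒜 : G → AddSubgroup Q) : Prop :=
  ∀ g h, ∀ a ∈ 𝒜 g, ∀ b ∈ 𝒜 h, (∀ x, a * x * b = 0) → a = 0 ∨ b = 0

theorem IsHomogeneous.inf {G Q : Type*} [Ring Q] {π : G → Q →+ Q} {I J : Ideal Q}
    (hI : IsHomogeneous π I) (hJ : IsHomogeneous π J) : IsHomogeneous π (I ⊓ J) :=
  fun x hx g => ⟨hI x hx.1 g, hJ x hx.2 g⟩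

namespace IsGrading

variable {𝒜 : G → AddSubgroup Q} {π : G → Q →+ Q} (H : IsGrading 𝒜 π)
include H

theorem proj_mul_right {h : G} {a : Q} (ha : a ∈ 𝒜 h) (g : G) (x : Q) :
    π g (x * a) = π (g * h⁻¹) x * a := by
  have hmem (k : G) : π k x * a ∈ 𝒜 (k * h) := H.mul_mem _ _ _ (H.proj_mem k x) _ ha
  conv_lhs => rw [← H.sum_proj x, Finset.sum_mul, map_sum]
  rw [Finset.sum_eq_single (g * h⁻¹)]
  · exact H.proj_self _ _ (by simpa only [inv_mul_cancel_right] using hmem (g * h⁻¹))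
  · exact fun k _ hk => H.proj_of_ne _ _ (fun hg => hk (eq_mul_inv_of_mul_eq hg.symm)) _ (hmem k)
  · exact fun hg => absurd (Finset.mem_univ _) hg

theorem proj_mul_left {h : G} {a : Q} (ha : a ∈ 𝒜 h) (g : G) (x : Q) :
    π g (a * x) = a * π (h⁻¹ * g) x := by
  have hmem (k : G) : a * π k x ∈ 𝒜 (h * k) := H.mul_mem _ _ _ ha _ (H.proj_mem k x)
  conv_lhs => rw [← H.sum_proj x, Finset.mul_sum, map_sum]
  rw [Finset.sum_eq_single (h⁻¹ * g)]
  · exact H.proj_self _ _ (by simpa only [mul_inv_cancel_left] using hmem (h⁻¹ * g))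
  · exact fun k _ hk => H.proj_of_ne _ _ (fun hg => hk (eq_inv_mul_of_mul_eq hg.symm)) _ (hmem k)
  · exact fun hg => absurd (Finset.mem_univ _) hg

theorem mem_of_proj_mem {S : Type*} [SetLike S Q] [AddSubmonoidClass S Q]
    {M : S} {x : Q} (h : ∀ g, π g x ∈ M) : x ∈ M := by
  rw [← H.sum_proj x]
  exact sum_mem fun g _ => h g

theorem proj_coeAddMonoidHom [DecidableEq G] (d : DirectSum G fun g => 𝒜 g) (g : G) :
    π g (DirectSum.coeAddMonoidHom 𝒜 d) = d g := by
  induction d using DirectSum.induction_on with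
  | zero => rw [map_zero, map_zero, DirectSum.zero_apply, ZeroMemClass.coe_zero]
  | of h x =>
    rw [DirectSum.coeAddMonoidHom_of]
    rcases eq_or_ne g h with rfl | hgh
    · rw [H.proj_self _ _ x.2, DirectSum.of_eq_same]
    · rw [H.proj_of_ne _ _ hgh _ x.2, DirectSum.of_eq_of_ne _ _ _ hgh, ZeroMemClass.coe_zero]
  | add x y hx hy => rw [map_add, map_add, hx, hy, DirectSum.add_apply, AddSubgroup.coe_add]

theorem isInternal [DecidableEq G] : DirectSum.IsInternal 𝒜 := by
  refine ⟨fun d e hde => DFinsupp.ext fun g => Subtype.ext ?_, fun x => ?_⟩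
  · rw [← H.proj_coeAddMonoidHom d g, ← H.proj_coeAddMonoidHom e g, hde]
  · refine ⟨∑ g, DirectSum.of (fun g => 𝒜 g) g ⟨π g x, H.proj_mem g x⟩, ?_⟩
    simp only [map_sum, DirectSum.coeAddMonoidHom_of]
    exact H.sum_proj x

theorem exists_homogeneous_ne_zero {I : Ideal Q} (hI : IsHomogeneous π I) (h0 : I ≠ ⊥) :
    ∃ g, ∃ a ∈ 𝒜 g, a ∈ I ∧ a ≠ 0 := by
  by_contra! h
  exact h0 (le_bot_iff.1 fun x hx =>
    H.mem_of_proj_mem fun g => h g _ (H.proj_mem g x) (hI x hx g))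

theorem isHomogeneous_ker_toSpanSingleton {h : G} {a : Q} (ha : a ∈ 𝒜 h) :
    IsHomogeneous π (LinearMap.ker (LinearMap.toSpanSingleton Q Q a)) := by
  intro x hx g
  replace hx : x * a = 0 := hx
  change π g x * a = 0
  rw [← mul_inv_cancel_right g h, ← H.proj_mul_right ha, hx, map_zero]

theorem isHomogeneous_map_toSpanSingleton {h : G} {a : Q} (ha : a ∈ 𝒜 h) {I : Ideal Q}
    (hI : IsHomogeneous π I) :
    IsHomogeneous π (Submodule.map (LinearMap.toSpanSingleton Q Q a) I) := by
  rintro _ ⟨x, hx, rfl⟩ g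
  exact ⟨π (g * h⁻¹) x, hI x hx _, (H.proj_mul_right ha g x).symm⟩

theorem mul_eq_zero_of_inf_mul_eq_zero (hprime : IsGrPrimeRing 𝒜) {I N : Ideal Q} [I.IsTwoSided]
    (hI : IsHomogeneous π I) (hI0 : I ≠ ⊥) (hN : IsHomogeneous π N) {h : G} {a : Q} (ha : a ∈ 𝒜 h)
    (hNI : ∀ x ∈ N ⊓ I, x * a = 0) : ∀ n ∈ N, n * a = 0 := by
  obtain ⟨k, i, hik, hiI, hi0⟩ := H.exists_homogeneous_ne_zero hI hI0
  have mul_proj_eq_zero (n : Q) (hn : n ∈ N) (g : G) : π g n * a = 0 := by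
    refine (hprime k _ i hik _ (H.mul_mem g h _ (H.proj_mem g n) a ha) fun x => ?_).resolve_left hi0
    rw [← mul_assoc]
    exact hNI _ ⟨N.mul_mem_left _ (hN n hn g), I.mul_mem_right _ (I.mul_mem_right x hiI)⟩
  intro n hn
  rw [← H.sum_proj n, Finset.sum_mul]
  exact Finset.sum_eq_zero fun g _ => mul_proj_eq_zero n hn g

theorem mul_eq_zero_of_minimal (hprime : IsGrPrimeRing 𝒜) {I L N : Ideal Q} [I.IsTwoSided]
    (hI : IsHomogeneous π I) (hI0 : I ≠ ⊥)
    (hL : Minimal (fun J : Ideal Q => IsHomogeneous π J ∧ J ≠ ⊥) L)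
    (hN : Minimal (fun J : Ideal Q => IsHomogeneous π J ∧ J ⊔ I = ⊤) N)
    {h : G} {a : Q} (ha : a ∈ 𝒜 h) (haL : a ∈ L) : ∀ n ∈ N, n * a = 0 := by
  set ρ := LinearMap.toSpanSingleton Q Q a
  by_cases hNI : Submodule.map ρ (N ⊓ I) = ⊥
  · exact H.mul_eq_zero_of_inf_mul_eq_zero hprime hI hI0 hN.prop.1 ha fun x hx =>
      (Submodule.mem_bot Q).1 (hNI ▸ Submodule.mem_map_of_mem (f := ρ) hx)
  -- `L = (N ⊓ I) a` by minimality, so modulo `N ⊓ I` every `n ∈ N` annihilates `a`; minimality of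
  -- `N` then puts all of `N` in the annihilator of `a`.
  have hL_le : L ≤ Submodule.map ρ (N ⊓ I) := by
    refine hL.le_of_le ⟨H.isHomogeneous_map_toSpanSingleton ha (hN.prop.1.inf hI), hNI⟩ ?_
    rintro _ ⟨x, -, rfl⟩
    exact L.mul_mem_left x haL
  have hN_le : N ≤ N ⊓ LinearMap.ker ρ ⊔ I := fun n hn => by
    obtain ⟨i, ⟨hiN, hiI⟩, hi⟩ := hL_le (L.mul_mem_left n haL)
    have hker : ρ (n - i) = 0 := by rw [map_sub, hi]; exact sub_self (n * a)
    rw [← sub_add_cancel n i]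
    exact Submodule.add_mem_sup ⟨N.sub_mem hn hiN, hker⟩ hiI
  have hle : N ≤ N ⊓ LinearMap.ker ρ :=
    hN.le_of_le ⟨hN.prop.1.inf (H.isHomogeneous_ker_toSpanSingleton ha),
      top_le_iff.1 (hN.prop.2.ge.trans (sup_le hN_le le_sup_right))⟩ inf_le_left
  exact fun n hn => (hle hn).2

theorem eq_bot_or_eq_top [IsArtinianRing Q] (hprime : IsGrPrimeRing 𝒜) {I : Ideal Q}
    [I.IsTwoSided] (hI : IsHomogeneous π I) : I = ⊥ ∨ I = ⊤ := by
  refine or_iff_not_imp_left.2 fun hI0 => ?_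
  obtain ⟨L, hL⟩ := exists_minimal_of_wellFoundedLT
    (fun J : Ideal Q => IsHomogeneous π J ∧ J ≠ ⊥) ⟨I, hI, hI0⟩
  obtain ⟨N, hN⟩ := exists_minimal_of_wellFoundedLT
    (fun J : Ideal Q => IsHomogeneous π J ∧ J ⊔ I = ⊤) ⟨⊤, fun _ _ _ => trivial, top_sup_eq I⟩
  have mul_eq_zero (n : Q) (hn : n ∈ N) (y : Q) (hy : y ∈ L) : n * y = 0 := by
    rw [← H.sum_proj y, Finset.mul_sum]
    exact Finset.sum_eq_zero fun g _ =>
      H.mul_eq_zero_of_minimal hprime hI hI0 hL hN (H.proj_mem g y) (hL.prop.1 y hy g) n hn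
  obtain ⟨g, a, hag, haL, ha0⟩ := H.exists_homogeneous_ne_zero hL.prop.1 hL.prop.2
  have hN0 : N = ⊥ := by
    by_contra hN0
    obtain ⟨h, n, hnh, hnN, hn0⟩ := H.exists_homogeneous_ne_zero hN.prop.1 hN0
    refine (hprime h g n hnh a hag fun x => ?_).elim hn0 ha0
    rw [mul_assoc]
    exact mul_eq_zero n hnN _ (L.mul_mem_left x haL)
  rw [← hN.prop.2, hN0, bot_sup_eq]

end IsGrading

variable {𝒜 : G → AddSubgroup Q} {π : G → Q →+ Q}

theorem IsGrading.restrict (H : IsGrading 𝒜 π) (Λ : Subring Q) (hΛ : ∀ g, ∀ x ∈ Λ, π g x ∈ Λ) :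
    IsGrading (fun g => (𝒜 g).comap Λ.subtype.toAddMonoidHom) fun g =>
      ((π g).comp Λ.subtype.toAddMonoidHom).codRestrict Λ fun x => hΛ g x x.2 where
  one_mem := H.one_mem
  mul_mem g h x hx y hy := H.mul_mem g h x hx y hy
  proj_mem g x := H.proj_mem g x
  proj_self g x hx := Subtype.ext (H.proj_self g x hx)
  proj_of_ne g h hne x hx := Subtype.ext (H.proj_of_ne g h hne x hx)
  sum_proj x := Subtype.ext <| by
    rw [AddSubmonoidClass.coe_finsetSum]
    exact H.sum_proj x

/-- The projections of the grading induced on `Q ⧸ I` by a grading of `Q` for which `I` is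
graded. -/
def quotientProj {I : Ideal Q} (hI : IsHomogeneous π I) (g : G) : Q ⧸ I →+ Q ⧸ I :=
  QuotientAddGroup.map _ _ (π g) fun x hx => hI x hx g

theorem IsGrading.quotient (H : IsGrading 𝒜 π) {I : Ideal Q} [I.IsTwoSided]
    (hI : IsHomogeneous π I) :
    IsGrading (fun g => (𝒜 g).map (Ideal.Quotient.mk I).toAddMonoidHom) (quotientProj hI) where
  one_mem := ⟨1, H.one_mem, map_one (Ideal.Quotient.mk I)⟩
  mul_mem := by
    rintro g h _ ⟨x, hx, rfl⟩ _ ⟨y, hy, rfl⟩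
    exact ⟨x * y, H.mul_mem g h x hx y hy, map_mul (Ideal.Quotient.mk I) x y⟩
  proj_mem g x := by
    obtain ⟨x, rfl⟩ := Ideal.Quotient.mk_surjective x
    exact ⟨_, H.proj_mem g x, rfl⟩
  proj_self := by
    rintro g _ ⟨x, hx, rfl⟩
    exact congrArg (Ideal.Quotient.mk I) (H.proj_self g x hx)
  proj_of_ne := by
    rintro g h hne _ ⟨x, hx, rfl⟩
    exact congrArg (Ideal.Quotient.mk I) (H.proj_of_ne g h hne x hx)
  sum_proj x := by
    obtain ⟨x, rfl⟩ := Ideal.Quotient.mk_surjective x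
    exact (map_sum (Ideal.Quotient.mk I) _ _).symm.trans
      (congrArg (Ideal.Quotient.mk I) (H.sum_proj x))

theorem IsHomogeneous.map_mk {G Q : Type*} [Ring Q] {π : G → Q →+ Q} {I J : Ideal Q}
    [I.IsTwoSided] (hJ : IsHomogeneous π J) (hI : IsHomogeneous π I) :
    IsHomogeneous (quotientProj hI) (J.map (Ideal.Quotient.mk I)) := by
  intro y hy g
  obtain ⟨x, hx, rfl⟩ :=
    (Ideal.mem_map_iff_of_surjective _ Ideal.Quotient.mk_surjective).1 hy
  exact Ideal.mem_map_of_mem (Ideal.Quotient.mk I) (hJ x hx g)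

theorem IsGrading.isHomogeneous_span_singleton (H : IsGrading 𝒜 π) {h : G} {a : Q}
    (ha : a ∈ 𝒜 h) : IsHomogeneous π (Ideal.span {a}) := by
  intro x hx g
  obtain ⟨y, rfl⟩ := Ideal.mem_span_singleton'.1 hx
  rw [H.proj_mul_right ha]
  exact Ideal.mul_mem_left _ _ (Ideal.mem_span_singleton_self a)

theorem IsGrading.isHomogeneous_colon (H : IsGrading 𝒜 π) {P W : Ideal Q}
    (hP : IsHomogeneous π P) (hW : IsHomogeneous π W) :
    IsHomogeneous π (P.colon (W : Set Q)) := by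
  refine fun s hs g => Submodule.mem_colon.2 fun w hw => ?_
  rw [smul_eq_mul, ← H.sum_proj w, Finset.mul_sum]
  refine P.sum_mem fun h _ => ?_
  rw [← mul_inv_cancel_right g h, ← H.proj_mul_right (H.proj_mem h w)]
  exact hP _ (Submodule.mem_colon.1 hs _ (hW w hw h)) (g * h)

/-- The right-handed analogue of `Submodule.colon`: the ideal of all `t` with `S t ⊆ P`. -/
def rightColon (P S : Ideal Q) [S.IsTwoSided] : Ideal Q where
  carrier := {t | ∀ s ∈ S, s * t ∈ P}
  zero_mem' s _ := by rw [mul_zero]; exact P.zero_mem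
  add_mem' ht ht' s hs := by rw [mul_add]; exact P.add_mem (ht s hs) (ht' s hs)
  smul_mem' c t ht s hs := by
    rw [smul_eq_mul, ← mul_assoc]; exact ht _ (S.mul_mem_right c hs)

theorem isTwoSided_rightColon (P S : Ideal Q) [P.IsTwoSided] [S.IsTwoSided] :
    (rightColon P S).IsTwoSided :=
  ⟨fun {t} y ht s hs => by rw [← mul_assoc]; exact P.mul_mem_right y (ht s hs)⟩

theorem IsGrading.isHomogeneous_rightColon (H : IsGrading 𝒜 π) {P S : Ideal Q} [S.IsTwoSided]
    (hP : IsHomogeneous π P) (hS : IsHomogeneous π S) : IsHomogeneous π (rightColon P S) := by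
  intro t ht g s hs
  rw [← H.sum_proj s, Finset.sum_mul]
  refine P.sum_mem fun h _ => ?_
  rw [← inv_mul_cancel_left h g, ← H.proj_mul_left (H.proj_mem h s)]
  exact hP _ (ht _ (hS s hs h)) (h * g)

end Grading

section Coefficients

variable {B A G : Type*} [Ring B] [Ring A] [Group G] {ι : B →+* A} {u : G → A}

/-- The additive isomorphism between the free left `B`-module with basis `G` and `A`. -/
noncomputable def coeffEquiv (hA : IsCrystallineGraded ι u) : (G →₀ B) ≃+ A :=
  AddEquiv.ofBijective
    (Finsupp.liftAddHom fun g => (AddMonoidHom.mulRight (u g)).comp ι.toAddMonoidHom)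
    hA.direct_sum

/-- The coefficient of `u g` in the expansion of an element of `A`. -/
noncomputable def coeff (hA : IsCrystallineGraded ι u) (g : G) : A →+ B :=
  (Finsupp.applyAddHom g).comp (coeffEquiv hA).symm.toAddMonoidHom

/-- The homogeneous part `x_g u_g` of degree `g` of `∑ x_h u_h`. -/
noncomputable def homogeneousPart (hA : IsCrystallineGraded ι u) (g : G) : A →+ A :=
  ((AddMonoidHom.mulRight (u g)).comp ι.toAddMonoidHom).comp (coeff hA g)

theorem homogeneousPart_apply (hA : IsCrystallineGraded ι u) (g : G) (x : A) :
    homogeneousPart hA g x = ι (coeff hA g x) * u g := rfl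

theorem coeff_sum (hA : IsCrystallineGraded ι u) (c : G →₀ B) (g : G) :
    coeff hA g (c.sum fun g b => ι b * u g) = c g :=
  DFunLike.congr_fun ((coeffEquiv hA).symm_apply_apply c) g

theorem coeff_mul_generator [DecidableEq G] (hA : IsCrystallineGraded ι u) (g h : G) (b : B) :
    coeff hA g (ι b * u h) = if h = g then b else 0 := by
  rw [← Finsupp.single_apply, ← coeff_sum hA, Finsupp.sum_single_index]
  rw [map_zero, zero_mul]

theorem sum_homogeneousPart [Fintype G] (hA : IsCrystallineGraded ι u) (x : A) :
    ∑ g, homogeneousPart hA g x = x := by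
  refine Eq.trans ?_ ((coeffEquiv hA).apply_symm_apply x)
  refine (Finsupp.sum_fintype _ (fun g b => ι b * u g) fun g => ?_).symm
  rw [map_zero, zero_mul]

theorem coeff_map_mul [Finite G] (hA : IsCrystallineGraded ι u) (g : G) (b : B) (x : A) :
    coeff hA g (ι b * x) = b * coeff hA g x := by
  classical
  cases nonempty_fintype G
  conv_lhs => rw [← sum_homogeneousPart hA x, Finset.mul_sum, map_sum]
  simp only [homogeneousPart_apply, ← mul_assoc, ← map_mul, coeff_mul_generator,
    Finset.sum_ite_eq', Finset.mem_univ, if_true]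

theorem mem_component_one (hA : IsCrystallineGraded ι u) {x : A} :
    x ∈ component ι u 1 ↔ ∃ b, ι b = x :=
  exists_congr fun b => by
    rw [AddMonoidHom.comp_apply, AddMonoidHom.mulRight_apply, hA.u_one, mul_one]
    rfl

theorem isGrading_component [Fintype G] (hA : IsCrystallineGraded ι u) :
    IsGrading (component ι u) (homogeneousPart hA) where
  one_mem := (mem_component_one hA).2 ⟨1, map_one ι⟩
  mul_mem := by
    rintro g h _ ⟨b, rfl⟩ _ ⟨c, rfl⟩
    obtain ⟨d, hd⟩ := hA.graded g h b c
    exact ⟨d, hd.symm⟩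
  proj_mem g x := ⟨coeff hA g x, rfl⟩
  proj_self := by
    classical
    rintro g _ ⟨b, rfl⟩
    change ι (coeff hA g (ι b * u g)) * u g = ι b * u g
    rw [coeff_mul_generator, if_pos rfl]
  proj_of_ne := by
    classical
    rintro g h hne _ ⟨b, rfl⟩
    change ι (coeff hA g (ι b * u h)) * u g = 0
    rw [coeff_mul_generator, if_neg hne.symm, map_zero, zero_mul]
  sum_proj := sum_homogeneousPart hA

theorem isGradedSet_iff (hA : IsCrystallineGraded ι u) (T : Set A) :
    IsGradedSet ι u T ↔ ∀ x ∈ T, ∀ g, homogeneousPart hA g x ∈ T := by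
  refine Iff.trans (forall_congr' fun c => ?_) (coeffEquiv hA).surjective.forall.symm
  change _ ↔ ((c.sum fun g b => ι b * u g) ∈ T →
    ∀ g, ι (coeff hA g (c.sum fun g b => ι b * u g)) * u g ∈ T)
  simp only [coeff_sum]

end Coefficients

section Lattices

theorem closure_smul_eq_span {R M : Type*} [Ring R] [AddCommGroup M] [Module R M] (s : Set M) :
    AddSubgroup.closure {y | ∃ r : R, ∃ x ∈ s, y = r • x} = (Submodule.span R s).toAddSubgroup := by
  refine le_antisymm ((AddSubgroup.closure_le _).2 ?_) fun x hx => ?_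
  · rintro _ ⟨r, x, hx, rfl⟩
    exact Submodule.smul_mem _ r (Submodule.subset_span hx)
  · refine Submodule.closure_induction (p := fun y _ => y ∈ AddSubgroup.closure _) (zero_mem _)
      (fun _ _ _ _ => add_mem) (fun r y hy => ?_) hx
    exact AddSubgroup.subset_closure ⟨r, y, hy, rfl⟩

theorem exists_finset_closure_of_le {R M : Type*} [Ring R] [AddCommGroup M] [Module R M]
    [IsNoetherianRing R] {N N' : AddSubgroup M} (hle : N' ≤ N)
    (hN' : ∀ r : R, ∀ x ∈ N', r • x ∈ N')
    (hN : ∃ s : Finset M, N = AddSubgroup.closure {y | ∃ r : R, ∃ x ∈ s, y = r • x}) :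
    ∃ s : Finset M, N' = AddSubgroup.closure {y | ∃ r : R, ∃ x ∈ s, y = r • x} := by
  obtain ⟨s, rfl⟩ := hN
  let N'' : Submodule R M := { N' with smul_mem' := hN' }
  have hle_span : N'' ≤ Submodule.span R (s : Set M) :=
    hle.trans (closure_smul_eq_span (R := R) (s : Set M)).le
  have := isNoetherian_of_fg_of_noetherian _ (Submodule.fg_span (R := R) s.finite_toSet)
  obtain ⟨t, ht⟩ := isNoetherian_submodule.1 this N'' hle_span
  exact ⟨t, (closure_smul_eq_span (R := R) (t : Set M)).symm.subst
    (congrArg Submodule.toAddSubgroup ht).symm⟩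

variable {R K A G : Type*} [CommRing R] [Field K] [Algebra R K] [Ring A] {ι : K →+* A}

variable (R ι) in
/-- `A` as a left `R`-module. -/
abbrev leftModule : Module R A := Module.compHom A (baseHom R ι)

variable (R ι) in
/-- `A` as a right `R`-module; as `R` is commutative, it is encoded as a left module. -/
abbrev rightModule : Module R A :=
  Module.compHom A ((baseHom R ι).toOpposite fun x y => (Commute.all x y).map (baseHom R ι))

theorem IsLattice.exists_fg_eq {M : AddSubgroup A} (hM : IsLattice R ι M) :
    letI := leftModule R ι
    ∃ N : Submodule R A, N.FG ∧ N.toAddSubgroup = M := by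
  let _ := leftModule R ι
  obtain ⟨s, hs⟩ := hM.left_fg
  exact ⟨Submodule.span R s, ⟨s, rfl⟩,
    ((closure_smul_eq_span (R := R) (s : Set A)).symm.trans hs.symm :)⟩

theorem IsFullLattice.of_le [IsNoetherianRing R] {M M' N : AddSubgroup A}
    (hN : IsLattice R ι N) (hM : IsFullLattice R ι M) (hMM' : M ≤ M') (hM'N : M' ≤ N)
    (hl : ∀ r : R, ∀ x ∈ M', baseHom R ι r * x ∈ M')
    (hr : ∀ r : R, ∀ x ∈ M', x * baseHom R ι r ∈ M') : IsFullLattice R ι M' where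
  left_mem := hl
  right_mem := hr
  left_torsion_free r x hx := hN.left_torsion_free r x (hM'N hx)
  right_torsion_free r x hx := hN.right_torsion_free r x (hM'N hx)
  left_fg := by
    let _ := leftModule R ι
    exact exists_finset_closure_of_le (R := R) hM'N hl hN.left_fg
  right_fg := by
    let _ := rightModule R ι
    exact exists_finset_closure_of_le (R := R) hM'N hr hN.right_fg
  left_full := by
    rw [eq_top_iff, ← hM.left_full]
    refine AddSubgroup.closure_mono ?_
    rintro _ ⟨k, x, hx, rfl⟩
    exact ⟨k, x, hMM' hx, rfl⟩
  right_full := by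
    rw [eq_top_iff, ← hM.right_full]
    refine AddSubgroup.closure_mono ?_
    rintro _ ⟨k, x, hx, rfl⟩
    exact ⟨k, x, hMM' hx, rfl⟩

end Lattices

section Orders

variable {R K A G : Type*} [CommRing R] [Field K] [Algebra R K] [Ring A] {ι : K →+* A} {u : G → A}
  {Λ : Subring A}

/-- The embedding of `R` in an order `Λ`. -/
def baseToOrder (hΛ : IsGradedOrder R ι u Λ) : R →+* Λ :=
  (baseHom R ι).codRestrict Λ (hΛ.baseHom_mem R)

theorem mem_inAmbient {P : Ideal Λ} {x : A} :
    x ∈ inAmbient P ↔ ∃ h : x ∈ Λ, (⟨x, h⟩ : Λ) ∈ P := by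
  constructor
  · rintro ⟨y, hy, rfl⟩
    exact ⟨y.2, hy⟩
  · rintro ⟨h, hx⟩
    exact ⟨⟨x, h⟩, hx, rfl⟩

theorem baseHom_mem_inAmbient (hΛ : IsGradedOrder R ι u Λ) {P : Ideal Λ} {r : R} :
    baseHom R ι r ∈ inAmbient P ↔ r ∈ P.comap (baseToOrder hΛ) := by
  rw [mem_inAmbient]
  exact exists_prop_of_true (hΛ.baseHom_mem R r)

theorem IsGradedOrder.exists_algebraMap_eq [IsNoetherianRing R] [IsIntegrallyClosed R]
    [IsFractionRing R K] (hι : Function.Injective ι) (hΛ : IsGradedOrder R ι u Λ) {k : K}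
    (hk : ι k ∈ Λ) : ∃ r : R, algebraMap R K r = k := by
  let S : Subalgebra R K := { Λ.comap ι with algebraMap_mem' := hΛ.baseHom_mem R }
  let _ := leftModule R ι
  obtain ⟨N, hN, hNΛ⟩ := hΛ.full.toIsLattice.exists_fg_eq
  let f : K →ₗ[R] A :=
    { ι.toAddMonoidHom with
      map_smul' := fun r x => (congrArg ι (Algebra.smul_def r x)).trans (map_mul ι _ x) }
  have hle : S.toSubmodule.map f ≤ N := by
    rintro _ ⟨x, hx, rfl⟩
    exact hNΛ.ge hx
  have := isNoetherian_of_fg_of_noetherian N hN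
  have hfg : S.toSubmodule.FG :=
    Submodule.fg_of_fg_map_injective f hι (isNoetherian_submodule.1 this _ hle)
  exact IsIntegrallyClosed.isIntegral_iff.1 (IsIntegral.of_mem_of_fg S hfg k hk)

variable [Group G]

theorem baseHom_mem_component_one (hA : IsCrystallineGraded ι u) (r : R) :
    baseHom R ι r ∈ component ι u 1 :=
  (mem_component_one hA).2 ⟨algebraMap R K r, rfl⟩

theorem inAmbient_inter_component_one [IsNoetherianRing R] [IsIntegrallyClosed R]
    [IsFractionRing R K] (hA : IsCrystallineGraded ι u) (hΛ : IsGradedOrder R ι u Λ)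
    (P : Ideal Λ) :
    (inAmbient P : Set A) ∩ component ι u 1 = ↑(inAmbient P) ∩ Set.range (baseHom R ι) := by
  ext x
  refine and_congr_right fun hx => ⟨fun hx1 => ?_, ?_⟩
  · obtain ⟨k, rfl⟩ := (mem_component_one hA).1 hx1
    obtain ⟨r, rfl⟩ := hΛ.exists_algebraMap_eq hA.ι_injective (mem_inAmbient.1 hx).1
    exact ⟨r, rfl⟩
  · rintro ⟨r, rfl⟩
    exact baseHom_mem_component_one hA r

theorem IsGrIdeal.exists_baseHom_mem [IsNoetherianRing R] [IsIntegrallyClosed R]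
    [IsFractionRing R K] [Finite G] (hA : IsCrystallineGraded ι u)
    (hΛ : IsGradedOrder R ι u Λ) {P : Ideal Λ} (hP : IsGrIdeal R ι u P) :
    ∃ r : R, r ≠ 0 ∧ baseHom R ι r ∈ inAmbient P := by
  classical
  obtain ⟨x, hxP, hx⟩ : ∃ x ∈ inAmbient P, coeff hA 1 x ≠ 0 := by
    by_contra! h
    have hle : (⊤ : AddSubgroup A) ≤ (coeff hA 1).ker := by
      rw [← hP.full.left_full, AddSubgroup.closure_le]
      rintro _ ⟨k, x, hx, rfl⟩
      exact (coeff_map_mul hA 1 k x).trans (by rw [h x hx, mul_zero])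
    have hcoeff : coeff hA 1 (ι 1 * u 1) = 0 := hle (AddSubgroup.mem_top _)
    rw [coeff_mul_generator, if_pos rfl] at hcoeff
    exact one_ne_zero hcoeff
  have hmem := (isGradedSet_iff hA _).1 hP.graded x hxP 1
  rw [homogeneousPart_apply, hA.u_one, mul_one] at hmem
  obtain ⟨r, hr⟩ := hΛ.exists_algebraMap_eq hA.ι_injective (mem_inAmbient.1 hmem).1
  rw [← hr] at hmem hx
  exact ⟨r, fun h => hx (h ▸ map_zero _), hmem⟩

/-- The homogeneous part of degree `g` of an element of a graded order. -/
noncomputable def orderPart (hA : IsCrystallineGraded ι u) (hΛ : IsGradedOrder R ι u Λ) (g : G) :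
    Λ →+ Λ :=
  ((homogeneousPart hA g).comp Λ.subtype.toAddMonoidHom).codRestrict Λ fun x =>
    (isGradedSet_iff hA _).1 hΛ.graded x x.2 g

theorem isGrading_order [Fintype G] (hA : IsCrystallineGraded ι u) (hΛ : IsGradedOrder R ι u Λ) :
    IsGrading (fun g => (component ι u g).comap Λ.subtype.toAddMonoidHom) (orderPart hA hΛ) :=
  (isGrading_component hA).restrict Λ fun g x hx => (isGradedSet_iff hA _).1 hΛ.graded x hx g

theorem isGradedSet_inAmbient_iff (hA : IsCrystallineGraded ι u)
    (hΛ : IsGradedOrder R ι u Λ) (P : Ideal Λ) :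
    IsGradedSet ι u (inAmbient P : Set A) ↔ IsHomogeneous (orderPart hA hΛ) P := by
  rw [isGradedSet_iff hA]
  constructor
  · intro h x hx g
    exact (mem_inAmbient.1 (h x (mem_inAmbient.2 ⟨x.2, hx⟩) g)).2
  · intro h x hx g
    obtain ⟨hxΛ, hxP⟩ := mem_inAmbient.1 hx
    exact mem_inAmbient.2 ⟨_, h _ hxP g⟩

theorem IsGrIdeal.isHomogeneous (hA : IsCrystallineGraded ι u) (hΛ : IsGradedOrder R ι u Λ)
    {P : Ideal Λ} (hP : IsGrIdeal R ι u P) : IsHomogeneous (orderPart hA hΛ) P :=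
  (isGradedSet_inAmbient_iff hA hΛ P).1 hP.graded

theorem IsGrIdeal.of_le [IsNoetherianRing R] (hA : IsCrystallineGraded ι u)
    (hΛ : IsGradedOrder R ι u Λ) {P S : Ideal Λ} (hP : IsGrIdeal R ι u P) (hPS : P ≤ S)
    (hS : S.IsTwoSided) (hSh : IsHomogeneous (orderPart hA hΛ) S) : IsGrIdeal R ι u S where
  two_sided := hS
  graded := (isGradedSet_inAmbient_iff hA hΛ S).2 hSh
  full := by
    refine .of_le hΛ.full.toIsLattice hP.full (AddSubgroup.map_mono hPS)
      (fun x hx => (mem_inAmbient.1 hx).1) (fun r x hx => ?_) (fun r x hx => ?_)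
    · exact mem_inAmbient.2 ⟨_, S.mul_mem_left (baseToOrder hΛ r) (mem_inAmbient.1 hx).2⟩
    · exact mem_inAmbient.2 ⟨_, S.mul_mem_right (baseToOrder hΛ r) (mem_inAmbient.1 hx).2⟩

end Orders

section Primes

variable {R K A G : Type*} [CommRing R] [Field K] [Algebra R K] [Ring A] [Group G] [Finite G]
  {ι : K →+* A} {u : G → A} {Λ : Subring A}

theorem IsGrPrime.mem_or_mem [IsNoetherianRing R] (hA : IsCrystallineGraded ι u)
    (hΛ : IsGradedOrder R ι u Λ) {P : Ideal Λ} (hP : IsGrPrime R ι u P) (a : Λ) {b : Λ} {h : G}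
    (hb : (b : A) ∈ component ι u h) (hab : ∀ x, a * x * b ∈ P) : a ∈ P ∨ b ∈ P := by
  cases nonempty_fintype G
  have H := isGrading_order hA hΛ
  have := hP.gr_ideal.two_sided
  have hPh := hP.gr_ideal.isHomogeneous hA hΛ
  -- `T` is the right residual of `S` modulo `P`, so that `S T ⊆ P` holds with `a ∈ S` and `b ∈ T`.
  set S := P.colon (Ideal.span {b} : Set Λ)
  have hSh : IsHomogeneous (orderPart hA hΛ) S :=
    H.isHomogeneous_colon hPh (H.isHomogeneous_span_singleton hb)
  have hS : IsGrIdeal R ι u S := hP.gr_ideal.of_le hA hΛ Ideal.le_colon inferInstance hSh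
  set T := rightColon P S
  have hT : IsGrIdeal R ι u T :=
    hP.gr_ideal.of_le hA hΛ (fun t ht s _ => P.mul_mem_left s ht) (isTwoSided_rightColon P S)
      (H.isHomogeneous_rightColon hPh hSh)
  have haS : a ∈ S := Submodule.mem_colon.2 fun w hw => by
    obtain ⟨y, rfl⟩ := Ideal.mem_span_singleton'.1 hw
    rw [smul_eq_mul, ← mul_assoc]
    exact hab y
  have hbT : b ∈ T := fun s hs =>
    Submodule.mem_colon.1 hs b (Ideal.mem_span_singleton_self b)
  exact (hP.prime S T hS hT fun s hs t ht => ht s hs).imp (· haS) (· hbT)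

theorem IsGrMaximal.isGrPrime [IsNoetherianRing R] (hA : IsCrystallineGraded ι u)
    (hΛ : IsGradedOrder R ι u Λ) {P : Ideal Λ} (hP : IsGrMaximal R ι u P) :
    IsGrPrime R ι u P where
  gr_ideal := hP.gr_ideal
  proper := hP.proper
  prime S T _ hT hST := by
    cases nonempty_fintype G
    have := hP.gr_ideal.two_sided
    have hcolon : IsGrIdeal R ι u (P.colon (T : Set Λ)) :=
      hP.gr_ideal.of_le hA hΛ Ideal.le_colon inferInstance
        ((isGrading_order hA hΛ).isHomogeneous_colon (hP.gr_ideal.isHomogeneous hA hΛ)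
          (hT.isHomogeneous hA hΛ))
    have hS : S ≤ P.colon (T : Set Λ) := fun s hs => Submodule.mem_colon.2 (hST s hs)
    by_cases htop : P.colon (T : Set Λ) = ⊤
    · exact Or.inr ((Submodule.colon_eq_top_iff_subset _).1 htop)
    · exact Or.inl (hS.trans (hP.maximal _ hcolon htop Ideal.le_colon).le)

theorem IsGrPrime.isGrPrimeRing_quotient [IsNoetherianRing R] (hA : IsCrystallineGraded ι u)
    (hΛ : IsGradedOrder R ι u Λ) {P : Ideal Λ} [P.IsTwoSided] (hP : IsGrPrime R ι u P) :
    IsGrPrimeRing (quotientComponent ι u P) := by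
  rintro g h _ ⟨a, -, rfl⟩ _ ⟨b, hb, rfl⟩ hab
  exact (hP.mem_or_mem hA hΛ a hb fun x =>
    Ideal.Quotient.eq_zero_iff_mem.1 (hab (Ideal.Quotient.mk P x))).imp
      Ideal.Quotient.eq_zero_iff_mem.2 Ideal.Quotient.eq_zero_iff_mem.2

end Primes

section Invariants

variable {R K A G : Type*} [CommRing R] [Field K] [Algebra R K] [Ring A] [Group G]
  [MulSemiringAction G R] {ι : K →+* A} {u : G → A} {Λ : Subring A}

instance isInvariant_fixedPoints_subring :
    Algebra.IsInvariant (FixedPoints.subring R G) R G :=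
  ⟨fun b hb => ⟨⟨b, hb⟩, rfl⟩⟩

theorem image_comap_fixedToOrder (hΛ : IsGradedOrder R ι u Λ) (P : Ideal Λ) :
    (fun a : FixedPoints.subring R G => baseHom R ι (a : R)) '' P.comap (fixedToOrder R hΛ)
      = ↑(inAmbient P) ∩ Set.range fun a : FixedPoints.subring R G => baseHom R ι (a : R) := by
  rw [← Set.image_preimage_eq_inter_range]
  exact congrArg _ (Set.ext fun a => (baseHom_mem_inAmbient hΛ).symm)

variable [Finite G]

theorem IsGrIdeal.comap_fixedToOrder_ne_bot [IsDomain R] [IsNoetherianRing R]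
    [IsIntegrallyClosed R] [IsFractionRing R K] (hA : IsCrystallineGraded ι u)
    (hΛ : IsGradedOrder R ι u Λ) {P : Ideal Λ} (hP : IsGrIdeal R ι u P) :
    P.comap (fixedToOrder R (G := G) hΛ) ≠ ⊥ := by
  have := Algebra.IsInvariant.isIntegral (FixedPoints.subring R G) R G
  obtain ⟨r, hr0, hr⟩ := hP.exists_baseHom_mem hA hΛ
  exact Ideal.comap_ne_bot_of_integral_mem (I := P.comap (baseToOrder hΛ)) hr0
    ((baseHom_mem_inAmbient hΛ).1 hr) (Algebra.IsIntegral.isIntegral r)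

theorem IsGrIdeal.inter_range_subset_fixed_iff [IsDomain R] [IsNoetherianRing R]
    [IsIntegrallyClosed R] [IsFractionRing R K] (hA : IsCrystallineGraded ι u)
    (hΛ : IsGradedOrder R ι u Λ) {P : Ideal Λ} (hP : IsGrIdeal R ι u P) :
    ↑(inAmbient P) ∩ Set.range (baseHom R ι)
        ⊆ Set.range (fun a : FixedPoints.subring R G => baseHom R ι (a : R)) ↔
      ∀ (g : G) (r : R), g • r = r := by
  refine ⟨fun hsub g r => ?_, fun htriv => ?_⟩
  · obtain ⟨t, ht0, ht⟩ := hP.exists_baseHom_mem hA hΛ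
    have smul_eq_self (s : R) (hs : baseHom R ι s ∈ inAmbient P) : g • s = s := by
      obtain ⟨a, ha⟩ := hsub ⟨hs, s, rfl⟩
      rw [← hA.ι_injective.comp (IsFractionRing.injective R K) ha]
      exact a.2 g
    have hrt := smul_eq_self (r * t) <| by
      rw [map_mul]
      exact hP.full.left_mem r _ ht
    rw [smul_mul', smul_eq_self t ht] at hrt
    exact mul_right_cancel₀ ht0 hrt
  · rintro _ ⟨-, r, rfl⟩
    exact ⟨⟨r, fun g => htriv g r⟩, rfl⟩

variable (hA : IsCrystallineGraded ι u)
  (hσ : ∀ (g : G) (r : R), u g * baseHom R ι r = baseHom R ι (g • r) * u g)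
  (hΛ : IsGradedOrder R ι u Λ)

include hA hσ in
theorem baseHom_mul_comm (a : FixedPoints.subring R G) (x : A) :
    baseHom R ι a * x = x * baseHom R ι a := by
  cases nonempty_fintype G
  rw [← sum_homogeneousPart hA x, Finset.mul_sum, Finset.sum_mul]
  refine Finset.sum_congr rfl fun g _ => ?_
  have hcomm : Commute (baseHom R ι a) (ι (coeff hA g x)) :=
    (Commute.all (algebraMap R K a) (coeff hA g x)).map ι
  rw [homogeneousPart_apply, mul_assoc _ (u g), hσ, a.2 g, ← mul_assoc, ← mul_assoc, hcomm.eq]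

include hA hσ in
theorem fixedToOrder_mul_comm (a : FixedPoints.subring R G) (x : Λ) :
    fixedToOrder R hΛ a * x = x * fixedToOrder R hΛ a :=
  Subtype.ext (baseHom_mul_comm hA hσ a x)

include hA hσ in
theorem IsGrPrime.isPrime_comap_fixedToOrder [IsNoetherianRing R] {P : Ideal Λ}
    (hP : IsGrPrime R ι u P) : (P.comap (fixedToOrder R (G := G) hΛ)).IsPrime := by
  refine ⟨Ideal.comap_ne_top _ hP.proper, fun {a b} hab => ?_⟩
  refine hP.mem_or_mem hA hΛ (fixedToOrder R hΛ a) (b := fixedToOrder R hΛ b)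
    (baseHom_mem_component_one hA _) fun x => ?_
  rw [fixedToOrder_mul_comm hA hσ, mul_assoc, ← map_mul]
  exact P.mul_mem_left x hab

/-- An order as an algebra over the invariant ring. -/
abbrev fixedAlgebra : Algebra (FixedPoints.subring R G) Λ :=
  (fixedToOrder R hΛ).toAlgebra' (fixedToOrder_mul_comm hA hσ hΛ)

variable [IsDedekindDomain R]

theorem finite_fixedAlgebra :
    letI := fixedAlgebra hA hσ hΛ
    Module.Finite (FixedPoints.subring R G) Λ := by
  let _ := fixedAlgebra hA hσ hΛ
  let _ := leftModule R ι
  let _ : Module R Λ := Module.compHom Λ (baseToOrder hΛ)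
  have : IsScalarTower (FixedPoints.subring R G) R Λ := ⟨fun a r x => Subtype.ext <| by
    change baseHom R ι (a * r) * (x : A) = baseHom R ι a * (baseHom R ι r * x)
    rw [map_mul, mul_assoc]⟩
  obtain ⟨N, hN, hNΛ⟩ := hΛ.full.toIsLattice.exists_fg_eq
  let f : N →ₗ[R] Λ :=
    { toFun := fun x => ⟨x, hNΛ.le x.2⟩
      map_add' := fun _ _ => rfl
      map_smul' := fun _ _ => rfl }
  have : Module.Finite R N := Module.Finite.iff_fg.2 hN
  have : Module.Finite R Λ := Module.Finite.of_surjective f fun x => ⟨⟨x, hNΛ.ge x.2⟩, rfl⟩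
  have := finite_of_isInvariant (FixedPoints.subring R G) R G
  exact Module.Finite.trans R Λ

include hA hσ in
theorem exists_finite_algebra_quotient (P : Ideal Λ) [P.IsTwoSided]
    {p : Ideal (FixedPoints.subring R G)} (hp : p ≤ P.comap (fixedToOrder R hΛ)) :
    ∃ _ : Algebra (FixedPoints.subring R G ⧸ p) (Λ ⧸ P),
      (∀ a : FixedPoints.subring R G,
        algebraMap (FixedPoints.subring R G ⧸ p) (Λ ⧸ P) (Ideal.Quotient.mk p a)
          = Ideal.Quotient.mk P (fixedToOrder R hΛ a)) ∧
      Module.Finite (FixedPoints.subring R G ⧸ p) (Λ ⧸ P) := by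
  let _ := fixedAlgebra hA hσ hΛ
  let alg : Algebra (FixedPoints.subring R G ⧸ p) (Λ ⧸ P) :=
    Ideal.Quotient.algebraQuotientOfLEComap hp
  have := finite_fixedAlgebra hA hσ hΛ
  have : IsScalarTower (FixedPoints.subring R G) (FixedPoints.subring R G ⧸ p) (Λ ⧸ P) :=
    ⟨fun a b x => by
      obtain ⟨b, rfl⟩ := Ideal.Quotient.mk_surjective b
      obtain ⟨x, rfl⟩ := Ideal.Quotient.mk_surjective x
      exact congrArg (Ideal.Quotient.mk P) (smul_assoc a b x)⟩
  exact ⟨alg, fun _ => rfl, Module.Finite.of_restrictScalars_finite (FixedPoints.subring R G) _ _⟩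

variable [IsFractionRing R K]

include hA hσ in
theorem IsGrPrime.isMaximal_comap_fixedToOrder {P : Ideal Λ} (hP : IsGrPrime R ι u P) :
    (P.comap (fixedToOrder R (G := G) hΛ)).IsMaximal :=
  have := isDedekindDomain_of_isInvariant (FixedPoints.subring R G) R G
  (hP.isPrime_comap_fixedToOrder hA hσ hΛ).isMaximal
    (hP.gr_ideal.comap_fixedToOrder_ne_bot hA hΛ)

include hA hσ hΛ in
theorem IsGrPrime.isArtinianRing_quotient {P : Ideal Λ} [P.IsTwoSided] (hP : IsGrPrime R ι u P) :
    IsArtinianRing (Λ ⧸ P) := by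
  let p := P.comap (fixedToOrder R (G := G) hΛ)
  have : p.IsMaximal := hP.isMaximal_comap_fixedToOrder hA hσ hΛ
  obtain ⟨_, -, _⟩ := exists_finite_algebra_quotient hA hσ hΛ P (le_refl p)
  let _ := Ideal.Quotient.field p
  exact IsArtinianRing.of_finite (FixedPoints.subring R G ⧸ p) (Λ ⧸ P)

include hσ in
theorem IsGrPrime.eq_bot_or_eq_top_of_isHomogeneous {P : Ideal Λ} [P.IsTwoSided]
    (hP : IsGrPrime R ι u P) {J : Ideal (Λ ⧸ P)} [J.IsTwoSided]
    (hJ : IsHomogeneous (quotientProj (hP.gr_ideal.isHomogeneous hA hΛ)) J) : J = ⊥ ∨ J = ⊤ := by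
  cases nonempty_fintype G
  have := hP.isArtinianRing_quotient hA hσ hΛ
  exact ((isGrading_order hA hΛ).quotient _).eq_bot_or_eq_top (hP.isGrPrimeRing_quotient hA hΛ) hJ

include hA hσ hΛ in
theorem IsGrPrime.isGrSimple_quotient {P : Ideal Λ} [P.IsTwoSided] (hP : IsGrPrime R ι u P) :
    IsGrSimple (quotientComponent ι u P) := by
  classical
  cases nonempty_fintype G
  have H : IsGrading (quotientComponent ι u P) _ :=
    (isGrading_order hA hΛ).quotient (hP.gr_ideal.isHomogeneous hA hΛ)
  refine ⟨H.isInternal, H.one_mem, H.mul_mem, Ideal.Quotient.nontrivial_iff.2 hP.proper,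
    fun J _ hJ => hP.eq_bot_or_eq_top_of_isHomogeneous hA hσ hΛ fun x hx g => ?_⟩
  refine hJ (Finsupp.equivFunOnFinite.symm fun g =>
    quotientProj (hP.gr_ideal.isHomogeneous hA hΛ) g x)
    (fun g => H.proj_mem g x) ?_ g
  rw [Finsupp.sum_fintype _ _ fun _ => rfl]
  exact (H.sum_proj x).symm ▸ hx

include hA hσ hΛ in
theorem IsGrPrime.isGrMaximal {P : Ideal Λ} (hP : IsGrPrime R ι u P) :
    IsGrMaximal R ι u P where
  gr_ideal := hP.gr_ideal
  proper := hP.proper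
  maximal Q hQ hQtop hPQ := by
    have := hP.gr_ideal.two_sided
    have := hQ.two_sided
    have hcomap := Ideal.comap_map_mk hPQ
    have : (Q.map (Ideal.Quotient.mk P)).IsTwoSided := ⟨fun {x} y hx => by
      obtain ⟨x, rfl⟩ := Ideal.Quotient.mk_surjective x
      obtain ⟨y, rfl⟩ := Ideal.Quotient.mk_surjective y
      rw [← map_mul, Ideal.mem_quotient_iff_mem hPQ]
      exact Q.mul_mem_right y ((Ideal.mem_quotient_iff_mem hPQ).1 hx)⟩
    rcases hP.eq_bot_or_eq_top_of_isHomogeneous hA hσ hΛ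
      ((hQ.isHomogeneous hA hΛ).map_mk (hP.gr_ideal.isHomogeneous hA hΛ)) with hbot | htop
    · rw [← hcomap, hbot, ← RingHom.ker_eq_comap_bot, Ideal.mk_ker]
    · exact absurd (by rw [← hcomap, htop, Ideal.comap_top]) hQtop

end Invariants

end Crystalline

theorem mainTheorem10 {R K A G : Type*} [CommRing R] [IsDedekindDomain R]
    [Field K] [Algebra R K] [IsFractionRing R K] [Ring A] [Group G] [Finite G]
    [MulSemiringAction G R] (ι : K →+* A) (u : G → A)
    (hA : Crystalline.IsCrystallineGraded ι u)
    (hσ : ∀ (g : G) (r : R),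
      u g * Crystalline.baseHom R ι r = Crystalline.baseHom R ι (g • r) * u g)
    (Λ : Subring A) (hΛ : Crystalline.IsGradedOrder R ι u Λ) :
    (∀ P : Ideal Λ, Crystalline.IsGrPrime R ι u P ↔ Crystalline.IsGrMaximal R ι u P) ∧
    ∀ (P : Ideal Λ) [P.IsTwoSided], Crystalline.IsGrPrime R ι u P →
      ∀ p : Ideal (FixedPoints.subring R G), p = P.comap (Crystalline.fixedToOrder R hΛ) →
      ∀ Pe : Set A, Pe = ↑(Crystalline.inAmbient P) ∩ ↑(Crystalline.component ι u 1) →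
        Pe = ↑(Crystalline.inAmbient P) ∩ Set.range (Crystalline.baseHom R ι) ∧
        (fun a : FixedPoints.subring R G => Crystalline.baseHom R ι (a : R)) '' p
          = Pe ∩ Set.range (fun a : FixedPoints.subring R G => Crystalline.baseHom R ι (a : R)) ∧
        (Pe = (fun a : FixedPoints.subring R G => Crystalline.baseHom R ι (a : R)) '' p ↔
          ∀ (g : G) (r : R), g • r = r) ∧
        p ≠ ⊥ ∧ p.IsPrime ∧ p.IsMaximal ∧
        (∃ alg : Algebra (FixedPoints.subring R G ⧸ p) (Λ ⧸ P),
          (∀ a : FixedPoints.subring R G,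
            algebraMap (FixedPoints.subring R G ⧸ p) (Λ ⧸ P) (Ideal.Quotient.mk p a)
              = Ideal.Quotient.mk P (Crystalline.fixedToOrder R hΛ a)) ∧
          Module.Finite (FixedPoints.subring R G ⧸ p) (Λ ⧸ P)) ∧
        Crystalline.IsGrSimple (Crystalline.quotientComponent ι u P) := by
  open Crystalline in
  refine ⟨fun P => ⟨fun hP => hP.isGrMaximal hA hσ hΛ, fun hP => hP.isGrPrime hA hΛ⟩, ?_⟩
  rintro P _ hP _ rfl _ rfl
  have hPe := inAmbient_inter_component_one hA hΛ P
  have hrange : Set.range (fun a : FixedPoints.subring R G => baseHom R ι (a : R))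
      ⊆ Set.range (baseHom R ι) := Set.range_comp_subset_range Subtype.val (baseHom R ι)
  have hp := image_comap_fixedToOrder hΛ P
  rw [← Set.inter_eq_right.2 hrange, ← Set.inter_assoc, ← hPe] at hp
  refine ⟨hPe, hp, ?_, hP.gr_ideal.comap_fixedToOrder_ne_bot hA hΛ,
    hP.isPrime_comap_fixedToOrder hA hσ hΛ, hP.isMaximal_comap_fixedToOrder hA hσ hΛ,
    exists_finite_algebra_quotient hA hσ hΛ P le_rfl, hP.isGrSimple_quotient hA hσ hΛ⟩
  rw [hp, eq_comm, Set.inter_eq_left, hPe]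
  exact hP.gr_ideal.inter_range_subset_fixed_iff hA hΛ
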